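/- Let $I$ (players) and $S$ (states of nature) be sets with $|I| \geq 2$ and $|S| \geq 2$. An $\infty$-field on a nonempty set $M$ is a field of subsets of $M$ that is closed under arbitrary intersections. For an $\infty$-field $\Sigma$ on $M$, let $\Delta^\infty(M,\Sigma)$ be the set of finitely additive probability measures on $(M,\Sigma)$, endowed with the $\infty$-field generated by the sets $\{\mu \mid \mu(E)\geq p\}$ with $E\in\Sigma$ and $p\in[0,1]$. An $\infty$-type space on $S$ for player set $I$ is a tuple $\langle M,\Sigma,(T_i)_{i\in I},\theta\rangle$, where $M$ is a nonempty set, $\Sigma$ is an $\infty$-field on $M$, each $T_i:M\to\Delta^\infty(M,\Sigma)$ is measurable and satisfies, for all $m\in M$ and $A\in\Sigma$: if $\{m'\in M\mid T_i(m')=T_i(m)\}\subseteq A$, then $T_i(m)(A)=1$; and $\theta:M\to S$ is $\Sigma$-$\mathrm{Pow}(S)$-measurable. A $*$-type space on $S$ for player set $I$ is a tuple $\langle M,(T_i)_{i\in I},\theta\rangle$, where $M$ is a nonempty set, each $T_i$ maps $M$ to the set of finitely additive probability measures on $(M,\mathrm{Pow}(M))$ and satisfies $T_i(m)(\{m'\in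 M\mid T_i(m')=T_i(m)\})=1$ for all $m\in M$, and $\theta:M\to S$ is a function. For such a space put $\Sigma=\mathrm{Pow}(M)$. A type morphism from $\langle M',\Sigma',(T'_i)_{i\in I},\theta'\rangle$ to $\langle M,\Sigma,(T_i)_{i\in I},\theta\rangle$ is a $\Sigma'$-$\Sigma$-measurable function $f:M'\to M$ such that $\theta'(m')=\theta(f(m'))$ and $T_i(f(m'))(E)=T'_i(m')(f^{-1}(E))$ for all $m'\in M'$, $E\in\Sigma$ and $i\in I$. An $\infty$-type space (respectively, a $*$-type space) on $S$ for player set $I$ is weak-universal if every $\infty$-type space (respectively, every $*$-type space) on $S$ for player set $I$ admits at least one, not necessarily unique, type morphism to it. Theorem. There is no weak-universal $\infty$-type space on $S$ for player set $I$, and there is no weak-universal $*$-type space on $S$ for player set $I$. -/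

import Mathlib

universe u v w

namespace TypeSpaces

/-- A field (algebra) of subsets of `M`. -/
structure SetField (M : Type u) where
  sets : Set (Set M)
  univ_mem : Set.univ ∈ sets
  compl_mem : ∀ A ∈ sets, Aᶜ ∈ sets
  inter_mem : ∀ A ∈ sets, ∀ B ∈ sets, A ∩ B ∈ sets

namespace SetField

theorem union_mem {M : Type u} (F : SetField M) {A B : Set M}
    (hA : A ∈ F.sets) (hB : B ∈ F.sets) : A ∪ B ∈ F.sets := by
  have h := F.compl_mem _ (F.inter_mem _ (F.compl_mem _ hA) _ (F.compl_mem _ hB))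
  rwa [Set.compl_inter, compl_compl, compl_compl] at h

/-- An `∞`-field: a field that is closed under arbitrary intersections. -/
def IsInfty {M : Type u} (F : SetField M) : Prop :=
  ∀ E : Set (Set M), E ⊆ F.sets → ⋂₀ E ∈ F.sets

/-- The field of all subsets of `M`. -/
def pow (M : Type u) : SetField M where
  sets := Set.univ
  univ_mem := Set.mem_univ _
  compl_mem := fun _ _ => Set.mem_univ _
  inter_mem := fun _ _ _ _ => Set.mem_univ _

/-- The `∞`-field generated by a family of sets: the smallest `∞`-field containing it. -/
def inftyGenerate {X : Type u} (G : Set (Set X)) : SetField X where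
  sets := {A | ∀ F : SetField X, F.IsInfty → G ⊆ F.sets → A ∈ F.sets}
  univ_mem := fun F _ _ => F.univ_mem
  compl_mem := fun A hA F hF hG => F.compl_mem A (hA F hF hG)
  inter_mem := fun A hA B hB F hF hG => F.inter_mem A (hA F hF hG) B (hB F hF hG)

theorem inftyGenerate_isInfty {X : Type u} (G : Set (Set X)) : (inftyGenerate G).IsInfty :=
  fun _ hE F hF hG => hF _ fun _ hA => hE hA F hF hG

/-- `F'`-`F`-measurability of a function. -/
def Measurable {M' : Type u} {M : Type v} (F' : SetField M') (F : SetField M)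
    (f : M' → M) : Prop :=
  ∀ E ∈ F.sets, f ⁻¹' E ∈ F'.sets

end SetField

/-- A finitely additive probability measure on the field `F`. It is a function on the members
of `F` only, so that two such measures are equal iff they agree on `F`. -/
structure FinAddProb {M : Type u} (F : SetField M) where
  toFun : F.sets → ℝ
  nonneg : ∀ A, 0 ≤ toFun A
  additive : ∀ (A B : Set M) (hA : A ∈ F.sets) (hB : B ∈ F.sets), Disjoint A B →
    toFun ⟨A ∪ B, F.union_mem hA hB⟩ = toFun ⟨A, hA⟩ + toFun ⟨B, hB⟩
  total : toFun ⟨Set.univ, F.univ_mem⟩ = 1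

/-- The `∞`-field on the space of finitely additive probability measures on `F` that is generated
by the sets `{μ | μ(E) ≥ p}`, for `E` in `F` and `p ∈ [0, 1]`. -/
def probField {M : Type u} (F : SetField M) : SetField (FinAddProb F) :=
  SetField.inftyGenerate
    {B | ∃ E : F.sets, ∃ p ∈ Set.Icc (0 : ℝ) 1, B = {μ | p ≤ μ.toFun E}}

/-- An `∞`-type space on `S` for player set `I`. -/
structure InftyTypeSpace (I : Type v) (S : Type w) where
  M : Type u
  nonempty : Nonempty M
  events : SetField M
  isInfty : events.IsInfty
  T : I → M → FinAddProb events
  measurable_T : ∀ i, SetField.Measurable events (probField events) (T i)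
  introspection : ∀ (i : I) (m : M) (A : events.sets),
    {m' | T i m' = T i m} ⊆ (A : Set M) → (T i m).toFun A = 1
  θ : M → S
  measurable_θ : SetField.Measurable events (SetField.pow S) θ

/-- A `*`-type space on `S` for player set `I`: all sets of states of the world are events. -/
structure StarTypeSpace (I : Type v) (S : Type w) where
  M : Type u
  nonempty : Nonempty M
  T : I → M → FinAddProb (SetField.pow M)
  introspection : ∀ (i : I) (m : M),
    (T i m).toFun ⟨{m' | T i m' = T i m}, Set.mem_univ _⟩ = 1
  θ : M → S

/-- Type morphisms between `∞`-type spaces. -/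
structure InftyTypeSpace.IsTypeMorphism {I : Type v} {S : Type w}
    (X Y : InftyTypeSpace.{u} I S) (f : X.M → Y.M) : Prop where
  measurable : SetField.Measurable X.events Y.events f
  nature : ∀ m, X.θ m = Y.θ (f m)
  beliefs : ∀ (m : X.M) (E : Set Y.M) (hE : E ∈ Y.events.sets) (i : I),
    (Y.T i (f m)).toFun ⟨E, hE⟩ = (X.T i m).toFun ⟨f ⁻¹' E, measurable E hE⟩

/-- Type morphisms between `*`-type spaces (here every function is measurable). -/
structure StarTypeSpace.IsTypeMorphism {I : Type v} {S : Type w}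
    (X Y : StarTypeSpace.{u} I S) (f : X.M → Y.M) : Prop where
  nature : ∀ m, X.θ m = Y.θ (f m)
  beliefs : ∀ (m : X.M) (E : Set Y.M) (i : I),
    (Y.T i (f m)).toFun ⟨E, Set.mem_univ _⟩ = (X.T i m).toFun ⟨f ⁻¹' E, Set.mem_univ _⟩

/-- Weak universality: every `∞`-type space (on the same `S`, for the same `I`) has some type
morphism into `U`. -/
def InftyTypeSpace.IsWeakUniversal {I : Type v} {S : Type w}
    (U : InftyTypeSpace.{u} I S) : Prop :=
  ∀ X : InftyTypeSpace.{u} I S, ∃ f : X.M → U.M, X.IsTypeMorphism U f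

/-- Weak universality: every `*`-type space (on the same `S`, for the same `I`) has some type
morphism into `U`. -/
def StarTypeSpace.IsWeakUniversal {I : Type v} {S : Type w}
    (U : StarTypeSpace.{u} I S) : Prop :=
  ∀ X : StarTypeSpace.{u} I S, ∃ f : X.M → U.M, X.IsTypeMorphism U f

end TypeSpaces

/-! A morphism into `U` pulls the events of `U` back to an `∞`-field containing the nature events
and closed under "player i is certain of E". It suffices to find a space where every such field
separates more points than `U` has. Well-order `W = Set U.M` and let one player know the first
coordinate of `W × W × Bool`, the others the second. A minimal type is certain that nature is
`true`; any other type is certain of `false` and that the opposite coordinate approaches its own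
strictly from below. By transfinite induction (`coord_eq_mem`) each value of a coordinate becomes an
event, so `Set U.M` injects into `U.M`, against Cantor. The test space has all sets as events, so it
serves both cases. -/

open Filter in
/-- On a linear order there are ultrafilters `D a` on `W × Bool` that charge the value `true` exactly
at the minimum, and that converge to `a` strictly from below otherwise. -/
theorem exists_ultrafilter_from_below (W : Type u) [LinearOrder W] :
    ∃ D : W → Ultrafilter (W × Bool),
      (∀ a, {x : W × Bool | x.2 = true} ∈ D a ↔ IsMin a) ∧
      ∀ a b, ¬ IsMin a → ({x : W × Bool | x.1 < b} ∈ D a ↔ a ≤ b) := by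
  have key : ∀ a : W, ∃ V : Ultrafilter (W × Bool),
      ({x : W × Bool | x.2 = true} ∈ V ↔ IsMin a) ∧
      ∀ b, ¬ IsMin a → ({x : W × Bool | x.1 < b} ∈ V ↔ a ≤ b) := by
    intro a
    by_cases ha : IsMin a
    · exact ⟨pure (a, true), by simp [ha], fun b h => absurd ha h⟩
    obtain ⟨c, hc⟩ := not_isMin_iff.1 ha
    have : Nonempty (Set.Iio a) := ⟨⟨c, hc⟩⟩
    refine ⟨(Ultrafilter.of (atTop : Filter (Set.Iio a))).map fun x => (x.1, false),
      by simp [ha], fun b _ => ?_⟩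
    rw [Ultrafilter.mem_map]
    constructor
    · intro h
      by_contra! hba
      -- The tail `[b, a)` lies in the ultrafilter and is disjoint from `{x < b}`.
      have h' : Set.Ici (⟨b, hba⟩ : Set.Iio a) ∈ Ultrafilter.of (atTop : Filter (Set.Iio a)) :=
        Ultrafilter.of_le _ (mem_atTop _)
      obtain ⟨x, hx, hx'⟩ := (Ultrafilter.of _).neBot.nonempty_of_mem (inter_mem h h')
      exact absurd hx (not_lt.2 (Subtype.coe_le_coe.2 hx'))
    · intro h
      exact Filter.univ_mem' fun x => lt_of_lt_of_le x.2 h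
  choose D hD using key
  exact ⟨D, fun a => (hD a).1, fun a => (hD a).2⟩

namespace TypeSpaces

namespace SetField

variable {M : Type u} {N : Type v}

/-- The preimage of a field of sets under a function. -/
def comap (f : M → N) (F : SetField N) : SetField M where
  sets := {A | ∃ E ∈ F.sets, f ⁻¹' E = A}
  univ_mem := ⟨_, F.univ_mem, rfl⟩
  compl_mem := by
    rintro _ ⟨E, hE, rfl⟩
    exact ⟨_, F.compl_mem _ hE, rfl⟩
  inter_mem := by
    rintro _ ⟨E, hE, rfl⟩ _ ⟨E', hE', rfl⟩
    exact ⟨_, F.inter_mem _ hE _ hE', rfl⟩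

theorem IsInfty.comap {F : SetField N} (hF : F.IsInfty) (f : M → N) :
    (F.comap f).IsInfty := by
  intro G hG
  -- Intersecting all events whose preimage lies in `G` avoids choosing one for each member.
  refine ⟨⋂₀ {E | E ∈ F.sets ∧ f ⁻¹' E ∈ G}, hF _ fun E hE => hE.1, ?_⟩
  ext m
  simp only [Set.mem_preimage, Set.mem_sInter, Set.mem_ofPred_eq]
  constructor
  · intro h A hA
    obtain ⟨E, hE, rfl⟩ := hG hA
    exact h E ⟨hE, hA⟩
  · exact fun h E hE => h _ hE.2

theorem IsInfty.iUnion_mem {F : SetField M} (hF : F.IsInfty) {ι : Sort*} {A : ι → Set M}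
    (hA : ∀ j, A j ∈ F.sets) : ⋃ j, A j ∈ F.sets := by
  have h := F.compl_mem _ (hF (Set.range fun j => (A j)ᶜ) (by
    rintro _ ⟨j, rfl⟩
    exact F.compl_mem _ (hA j)))
  rwa [Set.sInter_range, ← Set.compl_iUnion, compl_compl] at h

theorem pow_isInfty (M : Type u) : (pow M).IsInfty := fun _ _ => Set.mem_univ _

end SetField

open Classical in
/-- The `0`-`1`-valued finitely additive probability measure of an ultrafilter. -/
noncomputable def FinAddProb.ofUltrafilter {M : Type u} (V : Ultrafilter M) :
    FinAddProb (SetField.pow M) where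
  toFun A := if (A : Set M) ∈ V then 1 else 0
  nonneg A := by split_ifs <;> norm_num
  additive A B _ _ hAB := by
    have h : ¬ (A ∈ V ∧ B ∈ V) := fun h => by
      have := Filter.inter_mem h.1 h.2
      rw [hAB.inter_eq] at this
      exact V.empty_notMem this
    simp only [Ultrafilter.union_mem_iff]
    by_cases hA : A ∈ V <;> by_cases hB : B ∈ V <;> simp_all
  total := if_pos Filter.univ_mem

theorem FinAddProb.ofUltrafilter_eq_one {M : Type u} {V : Ultrafilter M} {A : Set M}
    (hA : A ∈ V) : (ofUltrafilter V).toFun ⟨A, Set.mem_univ _⟩ = 1 :=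
  if_pos hA

theorem FinAddProb.one_le_ofUltrafilter {M : Type u} {V : Ultrafilter M} {A : Set M} :
    1 ≤ (ofUltrafilter V).toFun ⟨A, Set.mem_univ _⟩ ↔ A ∈ V := by
  simp only [ofUltrafilter]
  split_ifs with h <;> simp [h]

section Construction

variable {W : Type u} (D : W → Ultrafilter (W × Bool))

/-- The belief of the player who knows the first coordinate (if `p` is true) or the second
coordinate (if `p` is false), when `D a` is the belief of type `a` about the other coordinates. -/
def coordBelief (p : Bool) (m : W × W × Bool) : Ultrafilter (W × W × Bool) :=
  if p then (D m.1).map fun x => (m.1, x.1, x.2)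
  else (D m.2.1).map fun x => (x.1, m.2.1, x.2)

/-- Introspection: a belief depends only on the known coordinate, and the pushforward keeps that
coordinate fixed. -/
theorem coordBelief_mem (p : Bool) (m : W × W × Bool) :
    {m' | coordBelief D p m' = coordBelief D p m} ∈ coordBelief D p m := by
  have h : ∀ x, coordBelief D p (if p then (m.1, x) else (x.1, m.2.1, x.2)) =
      coordBelief D p m := by
    cases p <;> exact fun _ => rfl
  cases p
  · exact Ultrafilter.mem_map.2 (Filter.univ_mem' h)
  · exact Ultrafilter.mem_map.2 (Filter.univ_mem' h)

/-- An `∞`-field that contains the events about nature and is closed under certain belief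
contains every event about one coordinate. -/
theorem coord_eq_mem [LinearOrder W] [WellFoundedLT W]
    (hmin : ∀ a, {x : W × Bool | x.2 = true} ∈ D a ↔ IsMin a)
    (hlt : ∀ a b, ¬ IsMin a → ({x : W × Bool | x.1 < b} ∈ D a ↔ a ≤ b))
    {C : SetField (W × W × Bool)} (hC : C.IsInfty)
    (hnature : {m : W × W × Bool | m.2.2 = true} ∈ C.sets)
    (hbelief : ∀ p, ∀ E ∈ C.sets, {m | E ∈ coordBelief D p m} ∈ C.sets) (a : W) :
    {m : W × W × Bool | m.1 = a} ∈ C.sets ∧ {m : W × W × Bool | m.2.1 = a} ∈ C.sets := by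
  have hmin₁ : {m : W × W × Bool | IsMin m.1} ∈ C.sets := by
    convert hbelief true _ hnature using 3 with m
    exact (hmin m.1).symm
  have hmin₂ : {m : W × W × Bool | IsMin m.2.1} ∈ C.sets := by
    convert hbelief false _ hnature using 3 with m
    exact (hmin m.2.1).symm
  induction a using WellFoundedLT.induction with
  | ind a ih =>
    -- Closure under arbitrary unions carries the induction through limit stages.
    have hlt₁ : {m : W × W × Bool | m.1 < a} ∈ C.sets := by
      convert hC.iUnion_mem fun b : Set.Iio a => (ih b.1 b.2).1 using 1
      ext m
      simp
    have hlt₂ : {m : W × W × Bool | m.2.1 < a} ∈ C.sets := by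
      convert hC.iUnion_mem fun b : Set.Iio a => (ih b.1 b.2).2 using 1
      ext m
      simp
    by_cases ha : IsMin a
    · have key : ∀ b : W, b = a ↔ IsMin b :=
        fun b => ⟨fun h => h ▸ ha, fun h => le_antisymm (isMin_iff_forall_not_lt.1 h a |> not_lt.1)
          (isMin_iff_forall_not_lt.1 ha b |> not_lt.1)⟩
      simpa only [key] using And.intro hmin₁ hmin₂
    -- Certainty of `x < a` gives `b ≤ a` for non-minimal `b`. Since each player's certainty
    -- concerns the other coordinate, both coordinates are treated in one induction.
    · have key : ∀ b : W, b = a ↔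
          {x : W × Bool | x.1 < a} ∈ D b ∧ ¬ IsMin b ∧ ¬ b < a := by
        intro b
        constructor
        · rintro rfl
          exact ⟨(hlt b b ha).2 le_rfl, ha, lt_irrefl b⟩
        · rintro ⟨h, hb, hba⟩
          exact le_antisymm ((hlt b a hb).1 h) (not_lt.1 hba)
      simp only [key]
      exact ⟨C.inter_mem _ (hbelief true _ hlt₂) _
          (C.inter_mem _ (C.compl_mem _ hmin₁) _ (C.compl_mem _ hlt₁)),
        C.inter_mem _ (hbelief false _ hlt₁) _
          (C.inter_mem _ (C.compl_mem _ hmin₂) _ (C.compl_mem _ hlt₂))⟩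

variable {I : Type v} {S : Type w}

open Classical in
/-- The `*`-type space on `W × W × Bool` in which player `i₀` knows the first coordinate, all other
players know the second one, and nature is determined by the third one. -/
noncomputable def coordSpace (i₀ : I) (s₀ s₁ : S) (w : W) : StarTypeSpace.{u} I S where
  M := W × W × Bool
  nonempty := ⟨(w, w, true)⟩
  T i m := FinAddProb.ofUltrafilter (coordBelief D (decide (i = i₀)) m)
  introspection i m := FinAddProb.ofUltrafilter_eq_one <|
    Filter.mem_of_superset (coordBelief_mem D (decide (i = i₀)) m)
      fun _ h => congrArg FinAddProb.ofUltrafilter h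
  θ m := if m.2.2 = true then s₁ else s₀

end Construction

/-- A `*`-type space, viewed as an `∞`-type space in which all sets are events. -/
def StarTypeSpace.toInfty {I : Type v} {S : Type w} (X : StarTypeSpace.{u} I S) :
    InftyTypeSpace.{u} I S where
  M := X.M
  nonempty := X.nonempty
  events := SetField.pow X.M
  isInfty := SetField.pow_isInfty X.M
  T := X.T
  measurable_T _ _ _ := Set.mem_univ _
  introspection i m A hA := by
    -- Monotonicity by hand: `A` has at least the mass of the type's class, which is 1, and at most
    -- the total mass.
    have hd : Disjoint {m' | X.T i m' = X.T i m} ((A : Set X.M) \ {m' | X.T i m' = X.T i m}) :=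
      Set.disjoint_sdiff_right
    have h₁ := (X.T i m).additive _ _ (Set.mem_univ _) (Set.mem_univ _) hd
    have h₂ := (X.T i m).additive (A : Set X.M) (A : Set X.M)ᶜ (Set.mem_univ _) (Set.mem_univ _)
      disjoint_compl_right
    have h₃ := (X.T i m).total
    have h₄ := X.introspection i m
    have h₅ := (X.T i m).nonneg
      ⟨(A : Set X.M) \ {m' | X.T i m' = X.T i m}, Set.mem_univ _⟩
    have h₆ := (X.T i m).nonneg ⟨(A : Set X.M)ᶜ, Set.mem_univ _⟩
    simp only [Set.union_sdiff_cancel hA, Set.union_compl_self] at h₁ h₂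
    change (X.T i m).toFun ⟨(A : Set X.M), Set.mem_univ _⟩ = 1
    linarith
  θ := X.θ
  measurable_θ _ _ := Set.mem_univ _

theorem StarTypeSpace.IsTypeMorphism.toInfty {I : Type v} {S : Type w}
    {X Y : StarTypeSpace.{u} I S} {f : X.M → Y.M} (hf : X.IsTypeMorphism Y f) :
    X.toInfty.IsTypeMorphism Y.toInfty f where
  measurable _ _ := Set.mem_univ _
  nature := hf.nature
  beliefs m E _ i := hf.beliefs m E i

/-- Every `∞`-type space fails to receive a type morphism from some `*`-type space. -/
theorem InftyTypeSpace.exists_star_not_isTypeMorphism {I : Type v} {S : Type w}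
    {i₀ i₁ : I} (hi : i₀ ≠ i₁) {s₀ s₁ : S} (hs : s₀ ≠ s₁) (U : InftyTypeSpace.{u} I S) :
    ∃ X : StarTypeSpace.{u} I S, ∀ f : X.M → U.M, ¬ X.toInfty.IsTypeMorphism U f := by
  classical
  obtain ⟨_, _⟩ := exists_wellFoundedLT (Set U.M)
  obtain ⟨D, hmin, hlt⟩ := exists_ultrafilter_from_below (Set U.M)
  refine ⟨coordSpace D i₀ s₀ s₁ ∅, fun f hf => ?_⟩
  change Set U.M × Set U.M × Bool → U.M at f
  have hnature : {m : Set U.M × Set U.M × Bool | m.2.2 = true} ∈ (U.events.comap f).sets := by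
    refine ⟨_, U.measurable_θ {s₁} (Set.mem_univ _), ?_⟩
    ext m
    have h : (if m.2.2 = true then s₁ else s₀) = U.θ (f m) := hf.nature m
    change U.θ (f m) = s₁ ↔ m.2.2 = true
    rw [← h]
    split_ifs with hm <;> simp [hm, hs]
  have hbelief : ∀ p, ∀ A ∈ (U.events.comap f).sets,
      {m | A ∈ coordBelief D p m} ∈ (U.events.comap f).sets := by
    rintro p _ ⟨E, hE, rfl⟩
    obtain ⟨i, rfl⟩ : ∃ i, decide (i = i₀) = p := by
      cases p
      · exact ⟨i₁, by simp [hi.symm]⟩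
      · exact ⟨i₀, by simp⟩
    -- The threshold `p = 1` suffices because the beliefs in the test space are `0`-`1`-valued.
    refine ⟨_, U.measurable_T i {μ | 1 ≤ μ.toFun ⟨E, hE⟩}
      fun F _ hF => hF ⟨⟨E, hE⟩, 1, by simp, rfl⟩, ?_⟩
    ext m
    change 1 ≤ (U.T i (f m)).toFun ⟨E, hE⟩ ↔ _
    rw [hf.beliefs m E hE i]
    exact FinAddProb.one_le_ofUltrafilter
  -- Freezing the other coordinates at arbitrary values leaves a map `Set U.M → U.M`.
  refine Function.cantor_injective (fun a => f (a, ∅, true)) fun a b hab => ?_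
  obtain ⟨E, -, hE⟩ :=
    (coord_eq_mem D hmin hlt (U.isInfty.comap f) hnature hbelief a).1
  have ha : (a, ∅, true) ∈ f ⁻¹' E := by rw [hE]; rfl
  have hb : (b, ∅, true) ∈ f ⁻¹' E := by
    rw [Set.mem_preimage] at ha ⊢
    exact (show f (a, ∅, true) = f (b, ∅, true) from hab) ▸ ha
  rw [hE] at hb
  exact hb.symm

end TypeSpaces

theorem theorem4 (I : Type v) (S : Type w)
    (hI : 2 ≤ Cardinal.mk I) (hS : 2 ≤ Cardinal.mk S) :
    (¬ ∃ U : TypeSpaces.InftyTypeSpace.{u} I S, U.IsWeakUniversal) ∧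
    (¬ ∃ U : TypeSpaces.StarTypeSpace.{u} I S, U.IsWeakUniversal) := by
  obtain ⟨i₀, i₁, hi⟩ := Cardinal.two_le_iff.1 hI
  obtain ⟨s₀, s₁, hs⟩ := Cardinal.two_le_iff.1 hS
  constructor
  · rintro ⟨U, hU⟩
    obtain ⟨X, hX⟩ := U.exists_star_not_isTypeMorphism hi hs
    obtain ⟨f, hf⟩ := hU X.toInfty
    exact hX f hf
  · rintro ⟨U, hU⟩
    obtain ⟨X, hX⟩ := U.toInfty.exists_star_not_isTypeMorphism hi hs
    obtain ⟨f, hf⟩ := hU X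
    exact hX f hf.toInfty
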